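/- Let $d \ge 1$ and $\lambda > 0$. Let $\Xi_0$ be a random non-empty compact subset of $\mathbb{R}^d$ (the typical grain), that is, a measurable map from a probability space into the space of non-empty compact subsets of $\mathbb{R}^d$ with the Borel $\sigma$-field of the Hausdorff metric. Let $\Pi_\lambda = \sum_{i \ge 1} \delta_{X_i}$ be a stationary Poisson process on $\mathbb{R}^d$ with intensity $\lambda$, let $\Xi_1, \Xi_2, \dots$ be independent copies of $\Xi_0$ that are independent of $(X_i)_{i \ge 1}$, and let $\Xi = \bigcup_{i \ge 1} (\Xi_i + X_i)$ be the corresponding stationary Poisson grain model. Write $|\cdot|$ for Lebesgue measure and $B_\varepsilon(o)$ for the closed ball of radius $\varepsilon$ about the origin, and suppose that $\mathbf{E}|\Xi_0| < \infty$. (a) If $\mathbf{E}|\Xi_0 + B_\varepsilon(o)| = \infty$ for every $\varepsilon > 0$, then $\mathbf{P}(\Xi \text{ is closed in } \mathbb{R}^d) = 0$, i.e. $\Xi$ is almost surely not closed. (b) $\Xi$ is almost surely closed if and only if $\mathbf{E}|\Xi_0 + B_\varepsilon(o)| < \infty$ for some $\varepsilon > 0$. -/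

import Mathlib

open MeasureTheory ProbabilityTheory TopologicalSpace
open scoped NNReal ENNReal Pointwise

/-- The space `𝒦` of nonempty compact subsets of `ℝᵈ` (with the Hausdorff metric) carries its
Borel σ-field. -/
instance nonemptyCompactsMeasurableSpace (d : ℕ) :
    MeasurableSpace (NonemptyCompacts (EuclideanSpace ℝ (Fin d))) :=
  borel _

instance nonemptyCompactsBorelSpace (d : ℕ) :
    BorelSpace (NonemptyCompacts (EuclideanSpace ℝ (Fin d))) :=
  ⟨rfl⟩

/-- The counting measure `∑ᵢ δ_{Xᵢ}` of a sequence of random points in `ℝᵈ`. -/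
noncomputable def pointProcess {d : ℕ} {Ω : Type*} (X : ℕ → Ω → EuclideanSpace ℝ (Fin d))
    (ω : Ω) : Measure (EuclideanSpace ℝ (Fin d)) :=
  Measure.sum fun i => Measure.dirac (X i ω)

/-- `∑ᵢ δ_{Xᵢ}` is a stationary Poisson process on `ℝᵈ` with intensity `lam`: the number of points
in a bounded Borel set `B` is Poisson distributed with mean `lam * |B|`, and the numbers of points
in finitely many pairwise disjoint bounded Borel sets are independent. -/
structure IsStationaryPoissonProcess {d : ℕ} {Ω : Type*} [MeasurableSpace Ω] (P : Measure Ω)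
    (lam : ℝ≥0) (X : ℕ → Ω → EuclideanSpace ℝ (Fin d)) : Prop where
  measurable_points : ∀ i, Measurable (X i)
  hasLaw_count : ∀ B : Set (EuclideanSpace ℝ (Fin d)), MeasurableSet B → Bornology.IsBounded B →
    HasLaw (fun ω => pointProcess X ω B)
      ((poissonMeasure (lam * (volume B).toNNReal)).map (fun n : ℕ => (n : ℝ≥0∞))) P
  indep_counts : ∀ (n : ℕ) (B : Fin n → Set (EuclideanSpace ℝ (Fin d))),
    (∀ j, MeasurableSet (B j)) → (∀ j, Bornology.IsBounded (B j)) →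
    Pairwise (fun j k => Disjoint (B j) (B k)) →
    iIndepFun (fun j ω => pointProcess X ω (B j)) P

/-- The data of a stationary Poisson grain model: `Ξ₀` is a random nonempty compact set (typical
grain), the germs `Xᵢ` are the points of a stationary Poisson process with intensity `lam`, and
the grains `Ξᵢ` are independent copies of `Ξ₀`, the sequence of grains being independent of the
sequence of germs. -/
structure IsPoissonGrainModel {d : ℕ} {Ω : Type*} [MeasurableSpace Ω] (P : Measure Ω)
    (lam : ℝ≥0) (Ξ₀ : Ω → NonemptyCompacts (EuclideanSpace ℝ (Fin d)))
    (X : ℕ → Ω → EuclideanSpace ℝ (Fin d))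
    (Ξ : ℕ → Ω → NonemptyCompacts (EuclideanSpace ℝ (Fin d))) : Prop where
  measurable_typicalGrain : Measurable Ξ₀
  germs : IsStationaryPoissonProcess P lam X
  measurable_grains : ∀ i, Measurable (Ξ i)
  identDistrib_grains : ∀ i, IdentDistrib (Ξ i) Ξ₀ P P
  iIndepFun_grains : iIndepFun Ξ P
  indepFun_germs_grains : IndepFun (fun ω i => X i ω) (fun ω i => Ξ i ω) P

/-- The union set `⋃ᵢ (Ξᵢ + Xᵢ)` of the shifted grains. -/
def grainUnion {d : ℕ} {Ω : Type*} (X : ℕ → Ω → EuclideanSpace ℝ (Fin d))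
    (Ξ : ℕ → Ω → NonemptyCompacts (EuclideanSpace ℝ (Fin d))) (ω : Ω) :
    Set (EuclideanSpace ℝ (Fin d)) :=
  ⋃ i, ((Ξ i ω : Set (EuclideanSpace ℝ (Fin d))) + {X i ω})

/-- The expected volume `𝐄|Ξ₀|` of a random compact set, with values in `[0, ∞]`. -/
noncomputable def meanVolume {d : ℕ} {Ω : Type*} [MeasurableSpace Ω] (P : Measure Ω)
    (Ξ₀ : Ω → NonemptyCompacts (EuclideanSpace ℝ (Fin d))) : ℝ≥0∞ :=
  ∫⁻ ω, volume (Ξ₀ ω : Set (EuclideanSpace ℝ (Fin d))) ∂P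

/-- The expected volume `𝐄|Ξ₀ + B_ε(o)|` of the Minkowski sum of a random compact set with the
closed ball of radius `ε` about the origin, with values in `[0, ∞]`. -/
noncomputable def meanDilatedVolume {d : ℕ} {Ω : Type*} [MeasurableSpace Ω] (P : Measure Ω)
    (Ξ₀ : Ω → NonemptyCompacts (EuclideanSpace ℝ (Fin d))) (ε : ℝ) : ℝ≥0∞ :=
  ∫⁻ ω, volume ((Ξ₀ ω : Set (EuclideanSpace ℝ (Fin d))) + Metric.closedBall 0 ε) ∂P

/-- The function `t ↦ exp (-t)` on `[0, ∞]`. -/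
noncomputable def negExp (t : ℝ≥0∞) : ℝ≥0∞ := (EReal.exp (t : EReal))⁻¹

/-- The function `u ↦ max (-log u) 0` on `[0, ∞]`. -/
noncomputable def negLog (u : ℝ≥0∞) : ℝ≥0∞ := (ENNReal.log u⁻¹).toENNReal

@[fun_prop]
lemma continuous_negExp : Continuous negExp :=
  continuous_inv.comp (ENNReal.continuous_exp.comp continuous_coe_ennreal_ereal)

@[fun_prop]
lemma measurable_negExp : Measurable negExp := continuous_negExp.measurable

@[fun_prop]
lemma measurable_negLog : Measurable negLog :=
  (ENNReal.measurable_log.comp measurable_inv).ereal_toENNReal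

lemma negExp_zero : negExp 0 = 1 := by simp [negExp]

lemma negExp_top : negExp ∞ = 0 := by simp [negExp]

lemma one_le_exp_coe (t : ℝ≥0∞) : 1 ≤ EReal.exp (t : EReal) := by
  simpa using EReal.coe_ennreal_nonneg t

lemma negExp_le_one (t : ℝ≥0∞) : negExp t ≤ 1 :=
  ENNReal.inv_le_one.2 (one_le_exp_coe t)

lemma negExp_add (a b : ℝ≥0∞) : negExp (a + b) = negExp a * negExp b := by
  have ha := (zero_lt_one.trans_le (one_le_exp_coe a)).ne'
  have hb := (zero_lt_one.trans_le (one_le_exp_coe b)).ne'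
  rw [negExp, EReal.coe_ennreal_add, EReal.exp_add, ENNReal.mul_inv (.inl ha) (.inr hb)]
  rfl

lemma negExp_sum {ι : Type*} (s : Finset ι) (f : ι → ℝ≥0∞) :
    negExp (∑ i ∈ s, f i) = ∏ i ∈ s, negExp (f i) := by
  classical
  induction s using Finset.induction_on with
  | empty => simp [negExp_zero]
  | insert a s ha ih => rw [Finset.sum_insert ha, Finset.prod_insert ha, negExp_add, ih]

lemma negExp_mul_natCast (c : ℝ≥0∞) (n : ℕ) : negExp (c * n) = negExp c ^ n := by
  have := negExp_sum (Finset.range n) fun _ => c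
  simpa [mul_comm] using this

lemma negExp_ofReal {x : ℝ} (hx : 0 ≤ x) :
    negExp (ENNReal.ofReal x) = ENNReal.ofReal (Real.exp (-x)) := by
  rw [negExp, EReal.coe_ennreal_ofReal, max_eq_left hx, EReal.exp_coe,
    ← ENNReal.ofReal_inv_of_pos (Real.exp_pos _), Real.exp_neg]

lemma negExp_negLog {u : ℝ≥0∞} (hu : u ≤ 1) : negExp (negLog u) = u := by
  rw [negExp, negLog, EReal.coe_toENNReal (by simpa using hu), ENNReal.exp_log, inv_inv]

lemma lintegral_poissonMeasure_pow (r : ℝ≥0) {u : ℝ≥0∞} (hu : u ≤ 1) :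
    ∫⁻ n, u ^ n ∂(poissonMeasure r) = negExp (r * (1 - u)) := by
  have hutop : u ≠ ∞ := ne_top_of_le_ne_top ENNReal.one_ne_top hu
  lift u to ℝ≥0 using hutop with v
  have hv : (v : ℝ) ≤ 1 := by exact_mod_cast hu
  have hR : (r : ℝ≥0∞) * (1 - (v : ℝ≥0∞)) = ENNReal.ofReal (r * (1 - v)) := by
    rw [ENNReal.ofReal_mul r.coe_nonneg, ENNReal.ofReal_sub _ v.coe_nonneg]
    simp
  rw [hR, negExp_ofReal (mul_nonneg r.coe_nonneg (by linarith)), poissonMeasure,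
    lintegral_sum_measure]
  have hs : HasSum (fun n : ℕ => Real.exp (-r) * ((r * v : ℝ) ^ n / n.factorial))
      (Real.exp (-r) * Real.exp (r * v)) := by
    have := (NormedSpace.expSeries_div_hasSum_exp (r * v : ℝ)).mul_left (Real.exp (-r))
    rwa [← Real.exp_eq_exp_ℝ] at this
  have he : -((r : ℝ) * (1 - v)) = -r + r * v := by ring
  rw [he, Real.exp_add, ← hs.tsum_eq, ENNReal.ofReal_tsum_of_nonneg (fun n => by positivity)
    hs.summable]
  refine tsum_congr fun n => ?_
  rw [lintegral_smul_measure, lintegral_dirac, smul_eq_mul,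
    show (v : ℝ≥0∞) ^ n = ENNReal.ofReal ((v : ℝ) ^ n) by
      rw [ENNReal.ofReal_pow v.coe_nonneg, ENNReal.ofReal_coe_nnreal],
    ← ENNReal.ofReal_mul (by positivity)]
  congr 1
  ring

section Germs

variable {d : ℕ} {Ω : Type*}

lemma pointProcess_apply (X : ℕ → Ω → EuclideanSpace ℝ (Fin d)) (ω : Ω)
    {B : Set (EuclideanSpace ℝ (Fin d))} (hB : MeasurableSet B) :
    pointProcess X ω B = ∑' i, B.indicator 1 (X i ω) := by
  rw [pointProcess, Measure.sum_apply _ hB]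
  exact tsum_congr fun i => Measure.dirac_apply' _ hB

lemma lintegral_pointProcess (X : ℕ → Ω → EuclideanSpace ℝ (Fin d)) (ω : Ω)
    {f : EuclideanSpace ℝ (Fin d) → ℝ≥0∞} (hf : Measurable f) :
    ∫⁻ x, f x ∂(pointProcess X ω) = ∑' i, f (X i ω) := by
  rw [pointProcess, lintegral_sum_measure]
  exact tsum_congr fun i => lintegral_dirac' _ hf

variable [MeasurableSpace Ω] {P : Measure Ω} {lam : ℝ≥0} {X : ℕ → Ω → EuclideanSpace ℝ (Fin d)}

namespace IsStationaryPoissonProcess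

lemma measurable_count (h : IsStationaryPoissonProcess P lam X)
    {B : Set (EuclideanSpace ℝ (Fin d))} (hB : MeasurableSet B) :
    Measurable fun ω => pointProcess X ω B := by
  simp_rw [pointProcess_apply X _ hB]
  exact .tsum fun i => (measurable_one.indicator hB).comp (h.measurable_points i)

lemma measurable_lintegral (h : IsStationaryPoissonProcess P lam X)
    {f : EuclideanSpace ℝ (Fin d) → ℝ≥0∞} (hf : Measurable f) :
    Measurable fun ω => ∫⁻ x, f x ∂(pointProcess X ω) := by
  simp_rw [lintegral_pointProcess X _ hf]
  exact .tsum fun i => hf.comp (h.measurable_points i)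

lemma lintegral_negExp_count (h : IsStationaryPoissonProcess P lam X)
    {B : Set (EuclideanSpace ℝ (Fin d))} (hB : MeasurableSet B) (hb : Bornology.IsBounded B)
    (c : ℝ≥0∞) :
    ∫⁻ ω, negExp (c * pointProcess X ω B) ∂P = negExp (lam * ((1 - negExp c) * volume B)) := by
  rw [(h.hasLaw_count B hB hb).lintegral_comp (f := fun t => negExp (c * t)) (by fun_prop),
    lintegral_map (by fun_prop) .of_discrete]
  simp_rw [negExp_mul_natCast]
  rw [lintegral_poissonMeasure_pow _ (negExp_le_one c), ENNReal.coe_mul,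
    ENNReal.coe_toNNReal hb.measure_lt_top.ne, mul_assoc, mul_comm (volume B)]

lemma lintegral_negExp_simpleFunc (h : IsStationaryPoissonProcess P lam X)
    (g : SimpleFunc (EuclideanSpace ℝ (Fin d)) ℝ≥0∞)
    (hg : Bornology.IsBounded (Function.support g)) :
    ∫⁻ ω, negExp (∫⁻ x, g x ∂(pointProcess X ω)) ∂P =
      negExp (lam * ∫⁻ x, (1 - negExp (g x))) := by
  classical
  let s := g.range.filter (· ≠ 0)
  let e := s.equivFin
  let B : Fin s.card → Set (EuclideanSpace ℝ (Fin d)) := fun j => g ⁻¹' {((e.symm j : s) : ℝ≥0∞)}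
  have hsum (φ : ℝ≥0∞ → ℝ≥0∞) (hφ : φ 0 = 0) (μ : Measure (EuclideanSpace ℝ (Fin d))) :
      ∫⁻ x, φ (g x) ∂μ = ∑ j, φ (e.symm j : s) * μ (B j) := by
    have h1 : ∫⁻ x, φ (g x) ∂μ = ∑ x ∈ g.range, φ x * μ (g ⁻¹' {x}) := by
      rw [← SimpleFunc.map_lintegral, ← SimpleFunc.lintegral_eq_lintegral]
      rfl
    rw [h1, Equiv.sum_comp e.symm (fun c : s => φ (c : ℝ≥0∞) * μ (g ⁻¹' {(c : ℝ≥0∞)})),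
      Finset.sum_coe_sort s (fun c => φ c * μ (g ⁻¹' {c}))]
    refine (Finset.sum_filter_of_ne fun x _ hx => ?_).symm
    rintro rfl
    simp [hφ] at hx
  have hBm j : MeasurableSet (B j) := g.measurableSet_fiber _
  have hBb j : Bornology.IsBounded (B j) := by
    refine hg.subset fun x hx => ?_
    have h1 : g x = (e.symm j : s) := hx
    have h2 := (Finset.mem_filter.1 (e.symm j).2).2
    rw [Function.mem_support, h1]
    exact h2
  have hBd : Pairwise fun j k => Disjoint (B j) (B k) := by
    intro j k hjk
    refine Disjoint.preimage _ (Set.disjoint_singleton.2 fun hc => hjk ?_)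
    exact e.symm.injective (Subtype.ext hc)
  have hi := (h.indep_counts _ B hBm hBb hBd).comp (fun j t => negExp ((e.symm j : s) * t))
    (fun j => by fun_prop)
  calc ∫⁻ ω, negExp (∫⁻ x, g x ∂(pointProcess X ω)) ∂P
      = ∫⁻ ω, ∏ j, negExp ((e.symm j : s) * pointProcess X ω (B j)) ∂P := by
        refine lintegral_congr fun ω => ?_
        rw [← negExp_sum]
        exact congrArg negExp (hsum id rfl _)
    _ = ∏ j, ∫⁻ ω, negExp ((e.symm j : s) * pointProcess X ω (B j)) ∂P :=
        lintegral_prod_eq_prod_lintegral_of_indepFun Finset.univ _ hi fun j =>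
          measurable_negExp.comp ((h.measurable_count (hBm j)).const_mul _)
    _ = _ := by
        simp_rw [fun j => h.lintegral_negExp_count (hBm j) (hBb j)]
        rw [← negExp_sum, ← Finset.mul_sum, hsum (fun c => 1 - negExp c) (by simp [negExp_zero])]

/-- The Laplace functional of a stationary Poisson process. -/
theorem laplace_functional [IsProbabilityMeasure P] (h : IsStationaryPoissonProcess P lam X)
    {f : EuclideanSpace ℝ (Fin d) → ℝ≥0∞} (hf : Measurable f) :
    ∫⁻ ω, negExp (∫⁻ x, f x ∂(pointProcess X ω)) ∂P =
      negExp (lam * ∫⁻ x, (1 - negExp (f x))) := by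
  let g : ℕ → SimpleFunc (EuclideanSpace ℝ (Fin d)) ℝ≥0∞ := fun n =>
    (SimpleFunc.eapprox f n).restrict (Metric.closedBall 0 n)
  have hgm n : MeasurableSet (Metric.closedBall (0 : EuclideanSpace ℝ (Fin d)) n) :=
    Metric.isClosed_closedBall.measurableSet
  have hga n x : g n x = (Metric.closedBall 0 (n : ℝ)).indicator (SimpleFunc.eapprox f n) x :=
    SimpleFunc.restrict_apply _ (hgm n) x
  have hmono : Monotone fun n x => g n x := by
    intro m n hmn x
    simp only [hga]
    exact (Set.indicator_le_indicator (SimpleFunc.monotone_eapprox f hmn x)).trans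
      (Set.indicator_le_indicator_of_subset
        (Metric.closedBall_subset_closedBall (by exact_mod_cast hmn)) (fun _ => zero_le) x)
  have hlim x : Filter.Tendsto (fun n => g n x) Filter.atTop (nhds (f x)) := by
    refine (SimpleFunc.tendsto_eapprox hf x).congr' ?_
    obtain ⟨N, hN⟩ := exists_nat_ge ‖x‖
    filter_upwards [Filter.eventually_ge_atTop N] with n hn
    rw [hga, Set.indicator_of_mem]
    simpa using hN.trans (by exact_mod_cast hn)
  have hint (μ : Measure (EuclideanSpace ℝ (Fin d))) :
      Filter.Tendsto (fun n => ∫⁻ x, g n x ∂μ) Filter.atTop (nhds (∫⁻ x, f x ∂μ)) :=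
    lintegral_tendsto_of_tendsto_of_monotone (fun n => (g n).measurable.aemeasurable)
      (.of_forall fun x m n hmn => hmono hmn x) (.of_forall hlim)
  have hL : Filter.Tendsto (fun n => ∫⁻ ω, negExp (∫⁻ x, g n x ∂(pointProcess X ω)) ∂P)
      Filter.atTop (nhds (∫⁻ ω, negExp (∫⁻ x, f x ∂(pointProcess X ω)) ∂P)) := by
    refine tendsto_lintegral_of_dominated_convergence (fun _ => 1)
      (fun n => measurable_negExp.comp (h.measurable_lintegral (g n).measurable))
      (fun n => .of_forall fun ω => negExp_le_one _) (by simp) (.of_forall fun ω => ?_)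
    exact (continuous_negExp.tendsto _).comp (hint _)
  have hanti : Antitone negExp := by
    intro a b hab
    exact ENNReal.inv_le_inv.2 (EReal.exp_monotone (by exact_mod_cast hab))
  have hR : Filter.Tendsto (fun n => negExp (lam * ∫⁻ x, (1 - negExp (g n x))))
      Filter.atTop (nhds (negExp (lam * ∫⁻ x, (1 - negExp (f x))))) := by
    refine (continuous_negExp.tendsto _).comp (ENNReal.Tendsto.const_mul ?_
      (.inr ENNReal.coe_ne_top))
    refine lintegral_tendsto_of_tendsto_of_monotone
      (fun n => (measurable_const.sub (measurable_negExp.comp (g n).measurable)).aemeasurable)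
      (.of_forall fun x m n hmn => tsub_le_tsub_left (hanti (hmono hmn x)) 1)
      (.of_forall fun x => ?_)
    exact ENNReal.Tendsto.sub tendsto_const_nhds ((continuous_negExp.tendsto _).comp (hlim x))
      (.inl ENNReal.one_ne_top)
  refine tendsto_nhds_unique hL (hR.congr fun n => ?_)
  refine (h.lintegral_negExp_simpleFunc (g n) ((Metric.isBounded_closedBall (x := 0)
    (r := (n : ℝ))).subset fun x hx => ?_)).symm
  by_contra hx'
  exact hx (by rw [hga, Set.indicator_of_notMem hx'])

end IsStationaryPoissonProcess

end Germs


lemma lintegral_poissonMeasure_natCast (r : ℝ≥0) :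
    ∫⁻ n : ℕ, (n : ℝ≥0∞) ∂(poissonMeasure r) = r := by
  have hsum : ∑' n : ℕ, ENNReal.ofReal (Real.exp (-r) * r ^ n / n.factorial) = 1 := by
    rw [← ENNReal.ofReal_tsum_of_nonneg (fun n => by positivity)
      (hasSum_one_poissonMeasure r).summable, (hasSum_one_poissonMeasure r).tsum_eq,
      ENNReal.ofReal_one]
  rw [poissonMeasure, lintegral_sum_measure]
  simp_rw [lintegral_smul_measure, lintegral_dirac, smul_eq_mul]
  rw [tsum_eq_zero_add' ENNReal.summable]
  simp only [Nat.cast_zero, mul_zero, zero_add]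
  calc ∑' n : ℕ, ENNReal.ofReal (Real.exp (-r) * r ^ (n + 1) / (n + 1).factorial) *
        ((n + 1 : ℕ) : ℝ≥0∞)
      = ∑' n : ℕ, r * ENNReal.ofReal (Real.exp (-r) * r ^ n / n.factorial) := by
        refine tsum_congr fun n => ?_
        rw [← ENNReal.ofReal_natCast, ← ENNReal.ofReal_coe_nnreal,
          ← ENNReal.ofReal_mul (by positivity), ← ENNReal.ofReal_mul (by positivity)]
        congr 1
        rw [Nat.factorial_succ]
        push_cast
        field_simp
        ring
    _ = r := by rw [ENNReal.tsum_mul_left, hsum, mul_one]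

namespace IsStationaryPoissonProcess

variable {d : ℕ} {Ω : Type*} [MeasurableSpace Ω] {P : Measure Ω} {lam : ℝ≥0}
  {X : ℕ → Ω → EuclideanSpace ℝ (Fin d)}

/-- The intensity measure of a stationary Poisson process. -/
lemma sum_map_eq (h : IsStationaryPoissonProcess P lam X) :
    Measure.sum (fun i => P.map (X i)) = (lam : ℝ≥0∞) • volume := by
  have hbdd (B : Set (EuclideanSpace ℝ (Fin d))) (hB : MeasurableSet B)
      (hb : Bornology.IsBounded B) :
      Measure.sum (fun i => P.map (X i)) B = ((lam : ℝ≥0∞) • volume) B := by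
    rw [Measure.sum_apply _ hB, Measure.smul_apply, smul_eq_mul]
    calc ∑' i, P.map (X i) B = ∑' i, ∫⁻ ω, B.indicator 1 (X i ω) ∂P := by
          refine tsum_congr fun i => ?_
          rw [← lintegral_map (measurable_one.indicator hB) (h.measurable_points i),
            lintegral_indicator_one hB]
      _ = ∫⁻ ω, pointProcess X ω B ∂P := by
          simp_rw [pointProcess_apply X _ hB]
          exact (lintegral_tsum fun i => ((measurable_one.indicator hB).comp
            (h.measurable_points i)).aemeasurable).symm
      _ = _ := by
          rw [(h.hasLaw_count B hB hb).lintegral_comp (f := fun t => t) (by fun_prop),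
            lintegral_map (by fun_prop) .of_discrete, lintegral_poissonMeasure_natCast,
            ENNReal.coe_mul, ENNReal.coe_toNNReal hb.measure_lt_top.ne]
  ext B hB
  have hU : B = ⋃ n : ℕ, B ∩ Metric.closedBall 0 n := by
    rw [← Set.inter_iUnion, Metric.iUnion_closedBall_nat, Set.inter_univ]
  have hmono : Monotone fun n : ℕ => B ∩ Metric.closedBall 0 (n : ℝ) := fun m n hmn =>
    Set.inter_subset_inter_right _ (Metric.closedBall_subset_closedBall (by exact_mod_cast hmn))
  rw [hU, hmono.measure_iUnion, hmono.measure_iUnion]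
  exact iSup_congr fun n => hbdd _ (hB.inter Metric.isClosed_closedBall.measurableSet)
    (Metric.isBounded_closedBall.subset Set.inter_subset_right)

end IsStationaryPoissonProcess

section Hitting

variable {d : ℕ} {Ω : Type*}

/-- The pairs of a germ `x` and a grain `K` such that the shifted grain `K + x` hits `S`. -/
def hittingPairs (S : Set (EuclideanSpace ℝ (Fin d))) :
    Set (EuclideanSpace ℝ (Fin d) × NonemptyCompacts (EuclideanSpace ℝ (Fin d))) :=
  {p | (((p.2 : Set (EuclideanSpace ℝ (Fin d))) + {p.1}) ∩ S).Nonempty}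

lemma mem_hittingPairs_iff {S : Set (EuclideanSpace ℝ (Fin d))} {x : EuclideanSpace ℝ (Fin d)}
    {K : NonemptyCompacts (EuclideanSpace ℝ (Fin d))} :
    (x, K) ∈ hittingPairs S ↔ x ∈ S - (K : Set (EuclideanSpace ℝ (Fin d))) := by
  constructor
  · rintro ⟨_, ⟨k, hk, _, rfl, rfl⟩, hS⟩
    exact ⟨_, hS, k, hk, by simp⟩
  · rintro ⟨s, hs, k, hk, rfl⟩
    exact ⟨s, ⟨k, hk, s - k, rfl, by simp⟩, hs⟩

lemma isClosed_hittingPairs {S : Set (EuclideanSpace ℝ (Fin d))} (hS : IsCompact S) :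
    IsClosed (hittingPairs S) := by
  have := isCompact_iff_compactSpace.1 hS
  let F : S × (EuclideanSpace ℝ (Fin d) × NonemptyCompacts (EuclideanSpace ℝ (Fin d))) → ℝ≥0∞ :=
    fun q => Metric.infEDist ((q.1 : EuclideanSpace ℝ (Fin d)) - q.2.1)
      (q.2.2 : Set (EuclideanSpace ℝ (Fin d)))
  have hF : Continuous F := by
    have h1 : Continuous fun q : S × (EuclideanSpace ℝ (Fin d) ×
        NonemptyCompacts (EuclideanSpace ℝ (Fin d))) =>
        ((q.1 : EuclideanSpace ℝ (Fin d)) - q.2.1, q.2.2.toCloseds) :=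
      (by fun_prop : Continuous fun q : S × (EuclideanSpace ℝ (Fin d) ×
        NonemptyCompacts (EuclideanSpace ℝ (Fin d))) =>
          (q.1 : EuclideanSpace ℝ (Fin d)) - q.2.1).prodMk
        (NonemptyCompacts.isometry_toCloseds.continuous.comp (by fun_prop))
    exact Closeds.continuous_infEDist.comp h1
  have h2 := isClosedMap_snd_of_compactSpace _ ((isClosed_singleton (x := (0 : ℝ≥0∞))).preimage hF)
  convert h2 using 1
  ext ⟨x, K⟩
  rw [mem_hittingPairs_iff]
  constructor
  · rintro ⟨s, hs, k, hk, rfl⟩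
    refine ⟨(⟨s, hs⟩, (s - k, K)), ?_, rfl⟩
    refine Metric.infEDist_zero_of_mem (?_ : s - (s - k) ∈ (K : Set _))
    simpa using hk
  · rintro ⟨⟨⟨s, hs⟩, y⟩, h0, rfl⟩
    refine ⟨s, hs, s - x, ?_, by simp⟩
    exact (Metric.mem_iff_infEDist_zero_of_closed K.isCompact.isClosed).2 h0

lemma measurableSet_hittingPairs {S : Set (EuclideanSpace ℝ (Fin d))} (hS : IsCompact S) :
    MeasurableSet (hittingPairs S) :=
  (isClosed_hittingPairs hS).measurableSet

lemma disjoint_grainUnion_iff {X : ℕ → Ω → EuclideanSpace ℝ (Fin d)}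
    {Ξ : ℕ → Ω → NonemptyCompacts (EuclideanSpace ℝ (Fin d))} {ω : Ω}
    {S : Set (EuclideanSpace ℝ (Fin d))} :
    Disjoint (grainUnion X Ξ ω) S ↔ ∀ i, (X i ω, Ξ i ω) ∉ hittingPairs S := by
  simp only [grainUnion, Set.disjoint_iUnion_left, hittingPairs, Set.mem_ofPred_eq,
    ← Set.not_disjoint_iff_nonempty_inter, not_not]

end Hitting

namespace IsPoissonGrainModel

variable {d : ℕ} {Ω : Type*} [MeasurableSpace Ω] {P : Measure Ω}
  {lam : ℝ≥0} {Ξ₀ : Ω → NonemptyCompacts (EuclideanSpace ℝ (Fin d))}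
  {X : ℕ → Ω → EuclideanSpace ℝ (Fin d)}
  {Ξ : ℕ → Ω → NonemptyCompacts (EuclideanSpace ℝ (Fin d))}
  {A : Set (EuclideanSpace ℝ (Fin d) × NonemptyCompacts (EuclideanSpace ℝ (Fin d)))}

lemma measurableSet_disjoint_grainUnion (h : IsPoissonGrainModel P lam Ξ₀ X Ξ)
    {S : Set (EuclideanSpace ℝ (Fin d))} (hS : IsCompact S) :
    MeasurableSet {ω | Disjoint (grainUnion X Ξ ω) S} := by
  simp_rw [disjoint_grainUnion_iff, Set.ofPred_forall]
  exact .iInter fun i => ((h.germs.measurable_points i).prodMk (h.measurable_grains i))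
    (measurableSet_hittingPairs hS).compl

variable [IsProbabilityMeasure P]

lemma measure_forall_grain_notMem (h : IsPoissonGrainModel P lam Ξ₀ X Ξ) (hA : MeasurableSet A)
    (x : ℕ → EuclideanSpace ℝ (Fin d)) :
    P {ω | ∀ i, (x i, Ξ i ω) ∉ A} =
      negExp (∑' i, negLog (1 - P.map Ξ₀ (Prod.mk (x i) ⁻¹' A))) := by
  have := Measure.isProbabilityMeasure_map (μ := P) h.measurable_typicalGrain.aemeasurable
  have hsec i : MeasurableSet (Prod.mk (x i) ⁻¹' A)ᶜ := (measurable_prodMk_left hA).compl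
  have hone i : P (Ξ i ⁻¹' (Prod.mk (x i) ⁻¹' A)ᶜ) =
      negExp (negLog (1 - P.map Ξ₀ (Prod.mk (x i) ⁻¹' A))) := by
    rw [negExp_negLog tsub_le_self, ← Measure.map_apply (h.measurable_grains i) (hsec i),
      (h.identDistrib_grains i).map_eq, prob_compl_eq_one_sub (measurable_prodMk_left hA)]
  have hset : {ω | ∀ i, (x i, Ξ i ω) ∉ A} =
      ⋂ m : ℕ, ⋂ i ∈ Finset.range m, Ξ i ⁻¹' (Prod.mk (x i) ⁻¹' A)ᶜ := by
    ext ω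
    simp only [Set.mem_ofPred_eq, Set.mem_iInter, Finset.mem_range, Set.mem_preimage,
      Set.mem_compl_iff]
    exact ⟨fun H m i _ => H i, fun H i => H (i + 1) i (Nat.lt_succ_self i)⟩
  have h1 := tendsto_measure_iInter_atTop (μ := P)
    (s := fun m : ℕ => ⋂ i ∈ Finset.range m, Ξ i ⁻¹' (Prod.mk (x i) ⁻¹' A)ᶜ)
    (fun m => (Finset.measurableSet_biInter _ fun i _ =>
      h.measurable_grains i (hsec i)).nullMeasurableSet)
    (fun m n hmn => Set.biInter_subset_biInter_left (Finset.range_mono hmn))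
    ⟨0, measure_ne_top _ _⟩
  rw [hset]
  refine tendsto_nhds_unique h1 ?_
  refine ((continuous_negExp.tendsto _).comp
    (ENNReal.summable.hasSum.tendsto_sum_nat)).congr fun m => ?_
  simp only [Function.comp_apply]
  rw [h.iIndepFun_grains.measure_inter_preimage_eq_mul _ fun i _ => hsec i, negExp_sum]
  exact Finset.prod_congr rfl fun i _ => (hone i).symm

/-- The probability that a measurable set contains no point of the marked Poisson process. -/
theorem measure_forall_notMem (h : IsPoissonGrainModel P lam Ξ₀ X Ξ) (hA : MeasurableSet A) :
    P {ω | ∀ i, (X i ω, Ξ i ω) ∉ A} = negExp (lam * (volume.prod (P.map Ξ₀)) A) := by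
  have := Measure.isProbabilityMeasure_map (μ := P) h.measurable_typicalGrain.aemeasurable
  have hX : Measurable fun ω i => X i ω := measurable_pi_lambda _ h.germs.measurable_points
  have hK : Measurable fun ω i => Ξ i ω := measurable_pi_lambda _ h.measurable_grains
  have := Measure.isProbabilityMeasure_map (μ := P) hK.aemeasurable
  let T : Set ((ℕ → EuclideanSpace ℝ (Fin d)) ×
      (ℕ → NonemptyCompacts (EuclideanSpace ℝ (Fin d)))) := {q | ∀ i, (q.1 i, q.2 i) ∉ A}
  have hT : MeasurableSet T := by
    have : T = ⋂ i, (fun q : (ℕ → EuclideanSpace ℝ (Fin d)) ×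
        (ℕ → NonemptyCompacts (EuclideanSpace ℝ (Fin d))) => (q.1 i, q.2 i)) ⁻¹' Aᶜ := by
      ext q
      simp [T]
    rw [this]
    exact .iInter fun i => (by fun_prop : Measurable fun q : (ℕ → EuclideanSpace ℝ (Fin d)) ×
        (ℕ → NonemptyCompacts (EuclideanSpace ℝ (Fin d))) => (q.1 i, q.2 i)) hA.compl
  have hg : Measurable fun x => negLog (1 - P.map Ξ₀ (Prod.mk x ⁻¹' A)) :=
    measurable_negLog.comp ((measurable_measure_prodMk_left hA).const_sub 1)
  calc P {ω | ∀ i, (X i ω, Ξ i ω) ∉ A}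
      = (P.map fun ω => ((fun i => X i ω), (fun i => Ξ i ω))) T := by
        rw [Measure.map_apply (hX.prodMk hK) hT]
        rfl
    _ = ∫⁻ ω, P.map (fun ω i => Ξ i ω) (Prod.mk (fun i => X i ω) ⁻¹' T) ∂P := by
        rw [h.indepFun_germs_grains.map_prod_eq_prod_map_map hX.aemeasurable hK.aemeasurable,
          Measure.prod_apply hT, lintegral_map (measurable_measure_prodMk_left hT) hX]
    _ = ∫⁻ ω, negExp (∫⁻ x, negLog (1 - P.map Ξ₀ (Prod.mk x ⁻¹' A)) ∂(pointProcess X ω)) ∂P := by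
        refine lintegral_congr fun ω => ?_
        rw [Measure.map_apply hK (measurable_prodMk_left hT),
          lintegral_pointProcess X ω hg,
          ← h.measure_forall_grain_notMem hA]
        rfl
    _ = negExp (lam * ∫⁻ x, P.map Ξ₀ (Prod.mk x ⁻¹' A)) := by
        rw [h.germs.laplace_functional hg]
        simp only [negExp_negLog tsub_le_self,
          ENNReal.sub_sub_cancel ENNReal.one_ne_top prob_le_one]
    _ = _ := by rw [Measure.prod_apply hA]

lemma prod_hittingPairs (h : IsPoissonGrainModel P lam Ξ₀ X Ξ)
    {S : Set (EuclideanSpace ℝ (Fin d))} (hS : IsCompact S) :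
    (volume.prod (P.map Ξ₀)) (hittingPairs S) =
      ∫⁻ ω, volume (S - (Ξ₀ ω : Set (EuclideanSpace ℝ (Fin d)))) ∂P := by
  have hm := measurableSet_hittingPairs hS
  have := Measure.isProbabilityMeasure_map (μ := P) h.measurable_typicalGrain.aemeasurable
  rw [Measure.prod_apply_symm hm,
    lintegral_map (measurable_measure_prodMk_right hm) h.measurable_typicalGrain]
  refine lintegral_congr fun ω => congrArg _ (Set.ext fun x => mem_hittingPairs_iff)

/-- The capacity functional of a Poisson grain model on compact sets. -/
theorem measure_disjoint_grainUnion (h : IsPoissonGrainModel P lam Ξ₀ X Ξ)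
    {S : Set (EuclideanSpace ℝ (Fin d))} (hS : IsCompact S) :
    P {ω | Disjoint (grainUnion X Ξ ω) S} =
      negExp (lam * ∫⁻ ω, volume (S - (Ξ₀ ω : Set (EuclideanSpace ℝ (Fin d)))) ∂P) := by
  simp_rw [disjoint_grainUnion_iff]
  rw [h.measure_forall_notMem (measurableSet_hittingPairs hS), h.prod_hittingPairs hS]

/-- Campbell's formula for the expected number of points of the marked Poisson process in a
measurable set. -/
theorem tsum_measure_mem (h : IsPoissonGrainModel P lam Ξ₀ X Ξ) (hA : MeasurableSet A) :
    ∑' i, P {ω | (X i ω, Ξ i ω) ∈ A} = lam * (volume.prod (P.map Ξ₀)) A := by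
  have := Measure.isProbabilityMeasure_map (μ := P) h.measurable_typicalGrain.aemeasurable
  have hone i : P {ω | (X i ω, Ξ i ω) ∈ A} =
      ∫⁻ x, P.map Ξ₀ (Prod.mk x ⁻¹' A) ∂(P.map (X i)) := by
    have := Measure.isProbabilityMeasure_map (μ := P) (h.measurable_grains i).aemeasurable
    have hi : IndepFun (X i) (Ξ i) P :=
      h.indepFun_germs_grains.comp (measurable_pi_apply i) (measurable_pi_apply i)
    rw [← (h.identDistrib_grains i).map_eq, ← Measure.prod_apply hA,
      ← hi.map_prod_eq_prod_map_map (h.germs.measurable_points i).aemeasurable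
        (h.measurable_grains i).aemeasurable,
      Measure.map_apply ((h.germs.measurable_points i).prodMk (h.measurable_grains i)) hA]
    rfl
  simp_rw [hone]
  rw [← lintegral_sum_measure, h.germs.sum_map_eq, lintegral_smul_measure, smul_eq_mul,
    Measure.prod_apply hA]

end IsPoissonGrainModel


section Volume

variable {d : ℕ}

lemma volume_closedBall_sub (y : EuclideanSpace ℝ (Fin d)) (ε : ℝ)
    {K : Set (EuclideanSpace ℝ (Fin d))} (hK : IsCompact K) :
    volume (Metric.closedBall y ε - K) = volume (K + Metric.closedBall 0 ε) := by
  have h : Metric.closedBall y ε - K = (fun x => y - x) ⁻¹' (K + Metric.closedBall 0 ε) := by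
    ext x
    constructor
    · rintro ⟨s, hs, k, hk, rfl⟩
      refine ⟨k, hk, y - s, ?_, by simp only; abel⟩
      rwa [mem_closedBall_zero_iff, ← dist_eq_norm, dist_comm]
    · rintro ⟨k, hk, b, hb, hx⟩
      refine ⟨y - b, ?_, k, hk, ?_⟩
      · rw [Metric.mem_closedBall, dist_eq_norm]
        simpa using hb
      · have : k + b = y - x := hx
        change y - b - k = x
        rw [sub_sub, add_comm b, this, sub_sub_cancel]
  rw [h, (Measure.measurePreserving_sub_left volume y).measure_preimage
    (hK.add (isCompact_closedBall 0 ε)).measurableSet.nullMeasurableSet]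

lemma volume_singleton_sub (y : EuclideanSpace ℝ (Fin d))
    {K : Set (EuclideanSpace ℝ (Fin d))} (hK : IsCompact K) :
    volume ({y} - K) = volume K := by
  have := volume_closedBall_sub y 0 hK
  rwa [Metric.closedBall_zero, Metric.closedBall_zero, Set.singleton_zero, add_zero] at this

lemma volume_pair_sub (y z : EuclideanSpace ℝ (Fin d)) (K : Set (EuclideanSpace ℝ (Fin d))) :
    volume ({y, z} - K) = volume ({0, z - y} - K) := by
  rw [← measure_preimage_add_right volume (-y) ({0, z - y} - K)]
  congr 1
  ext x
  simp only [Set.mem_sub, Set.mem_insert_iff, Set.mem_singleton_iff, exists_eq_or_imp,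
    exists_eq_left, Set.mem_preimage]
  refine or_congr (exists_congr fun k => and_congr_right fun _ => ?_)
    (exists_congr fun k => and_congr_right fun _ => ?_)
  · rw [← sub_eq_add_neg, eq_sub_iff_add_eq, zero_sub, neg_add_eq_sub]
  · rw [← sub_eq_add_neg, eq_sub_iff_add_eq, sub_right_comm, sub_add_cancel]

lemma volume_pair_sub_le (z : EuclideanSpace ℝ (Fin d)) {K : Set (EuclideanSpace ℝ (Fin d))}
    (hK : IsCompact K) : volume ({0, z} - K) ≤ 2 * volume K := by
  rw [Set.insert_eq, Set.union_sub]
  refine (measure_union_le _ _).trans ?_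
  rw [volume_singleton_sub _ hK, volume_singleton_sub _ hK, two_mul]

lemma eventually_volume_pair_sub_eq {K : Set (EuclideanSpace ℝ (Fin d))} (hK : IsCompact K) :
    ∀ᶠ z in Bornology.cobounded (EuclideanSpace ℝ (Fin d)),
      volume ({0, z} - K) = 2 * volume K := by
  obtain ⟨M, hM⟩ := hK.isBounded.exists_norm_le
  filter_upwards [(tendsto_norm_cobounded_atTop (E := EuclideanSpace ℝ (Fin d))).eventually
    (Filter.eventually_gt_atTop (M + M))] with z hz
  rw [Set.insert_eq, Set.union_sub, measure_union, volume_singleton_sub _ hK,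
    volume_singleton_sub _ hK, two_mul]
  · rw [Set.disjoint_left]
    rintro _ ⟨_, rfl, k, hk, rfl⟩ ⟨z, rfl, l, hl, hkl⟩
    have h1 : z = l - k := by
      have : z - l = 0 - k := hkl
      rw [sub_eq_iff_eq_add] at this
      rw [this]
      abel
    have h2 := norm_sub_le l k
    rw [← h1] at h2
    linarith [hM k hk, hM l hl]
  · rw [sub_eq_add_neg]
    exact (isCompact_singleton.add hK.neg).measurableSet

end Volume

/-- The second moment bound for the probability that none of `n` events of probability `q` with
almost nonpositive correlations occurs. -/
lemma measureReal_forall_notMem_mul_le {Ω : Type*} [MeasurableSpace Ω] {P : Measure Ω}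
    [IsProbabilityMeasure P] {V : ℕ → Set Ω} (hV : ∀ j, MeasurableSet (V j)) {q δ : ℝ}
    (hδ : 0 ≤ δ) (hq : ∀ j, P.real (V j) = q)
    (hqq : ∀ j k, j ≠ k → P.real (V j ∩ V k) ≤ q ^ 2 + δ) (n : ℕ) :
    (n * q) ^ 2 * P.real {ω | ∀ j, ω ∉ V j} ≤ n + n ^ 2 * δ := by
  let I : ℕ → Ω → ℝ := fun j => (V j).indicator 1
  have hI j : Integrable (I j) P := (integrable_const (1 : ℝ)).indicator (hV j)
  have hII j k : (fun ω => (I j ω - q) * (I k ω - q)) =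
      fun ω => (V j ∩ V k).indicator 1 ω - q * I j ω - q * I k ω + q ^ 2 := by
    funext ω
    have : (V j ∩ V k).indicator (1 : Ω → ℝ) ω = I j ω * I k ω := by
      rw [Set.inter_indicator_one]; rfl
    rw [this]
    ring
  have hIJ j k : Integrable ((V j ∩ V k).indicator (1 : Ω → ℝ)) P :=
    (integrable_const (1 : ℝ)).indicator ((hV j).inter (hV k))
  have hint j k : Integrable (fun ω => (I j ω - q) * (I k ω - q)) P := by
    rw [hII]
    exact (((hIJ j k).sub ((hI j).const_mul q)).sub ((hI k).const_mul q)).add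
      (integrable_const _)
  have hval j k : ∫ ω, (I j ω - q) * (I k ω - q) ∂P = P.real (V j ∩ V k) - q ^ 2 := by
    have h1 j : ∫ ω, I j ω ∂P = q := by rw [← hq j]; exact integral_indicator_one (hV j)
    have h2 : Integrable (fun ω => (V j ∩ V k).indicator 1 ω - q * I j ω) P :=
      (hIJ j k).sub ((hI j).const_mul q)
    have h3 : Integrable (fun ω => (V j ∩ V k).indicator 1 ω - q * I j ω - q * I k ω) P :=
      h2.sub ((hI k).const_mul q)
    rw [hII, integral_add h3 (integrable_const _), integral_sub h2 ((hI k).const_mul q),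
      integral_sub (hIJ j k) ((hI j).const_mul q), integral_const_mul, integral_const_mul, h1, h1,
      integral_indicator_one ((hV j).inter (hV k))]
    simp
    ring
  have hbound j k : P.real (V j ∩ V k) - q ^ 2 ≤ (if j = k then 1 else 0) + δ := by
    split_ifs with hjk
    · nlinarith [measureReal_le_one (μ := P) (s := V j ∩ V k)]
    · linarith [hqq j k hjk]
  have hsq : (fun ω => (∑ j ∈ Finset.range n, (I j ω - q)) ^ 2) =
      fun ω => ∑ j ∈ Finset.range n, ∑ k ∈ Finset.range n, (I j ω - q) * (I k ω - q) := by
    funext ω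
    rw [sq, Finset.sum_mul_sum]
  have hsqint : Integrable (fun ω => (∑ j ∈ Finset.range n, (I j ω - q)) ^ 2) P := by
    rw [hsq]
    exact integrable_finsetSum _ fun j _ => integrable_finsetSum _ fun k _ => hint j k
  have hvar : ∫ ω, (∑ j ∈ Finset.range n, (I j ω - q)) ^ 2 ∂P ≤ n + n ^ 2 * δ := by
    rw [hsq, integral_finsetSum _ fun j _ => integrable_finsetSum _ fun k _ => hint j k]
    calc _ ≤ ∑ j ∈ Finset.range n, ∑ k ∈ Finset.range n, ((if j = k then 1 else 0) + δ) := by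
          refine Finset.sum_le_sum fun j _ => ?_
          rw [integral_finsetSum _ fun k _ => hint j k]
          exact Finset.sum_le_sum fun k _ => (hval j k).trans_le (hbound j k)
      _ = n + n ^ 2 * δ := by
          simp only [Finset.sum_add_distrib, Finset.sum_ite_eq, Finset.sum_const,
            Finset.card_range, nsmul_eq_mul]
          rw [Finset.sum_congr rfl fun j hj => if_pos hj]
          simp
          ring
  refine le_trans ?_ ((mul_meas_ge_le_integral_of_nonneg
    (.of_forall fun ω => sq_nonneg _) hsqint ((n * q) ^ 2)).trans hvar)
  refine mul_le_mul_of_nonneg_left (measureReal_mono fun ω hω => ?_) (sq_nonneg _)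
  have h0 : ∀ j, I j ω = 0 := fun j => Set.indicator_of_notMem (hω j) _
  simp [h0]

namespace IsPoissonGrainModel

variable {d : ℕ} {Ω : Type*} [MeasurableSpace Ω] {P : Measure Ω} [IsProbabilityMeasure P]
  {lam : ℝ≥0} {Ξ₀ : Ω → NonemptyCompacts (EuclideanSpace ℝ (Fin d))}
  {X : ℕ → Ω → EuclideanSpace ℝ (Fin d)}
  {Ξ : ℕ → Ω → NonemptyCompacts (EuclideanSpace ℝ (Fin d))}

omit [IsProbabilityMeasure P] in
lemma measurable_volume_sub (h : IsPoissonGrainModel P lam Ξ₀ X Ξ)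
    {S : Set (EuclideanSpace ℝ (Fin d))} (hS : IsCompact S) :
    Measurable fun ω => volume (S - (Ξ₀ ω : Set (EuclideanSpace ℝ (Fin d)))) := by
  convert (measurable_measure_prodMk_right (μ := volume) (measurableSet_hittingPairs hS)).comp
    h.measurable_typicalGrain using 2 with ω
  exact congrArg _ (Set.ext fun x => mem_hittingPairs_iff.symm)

lemma lintegral_volume_closedBall_sub (P : Measure Ω)
    (Ξ₀ : Ω → NonemptyCompacts (EuclideanSpace ℝ (Fin d))) (y : EuclideanSpace ℝ (Fin d)) (ε : ℝ) :
    ∫⁻ ω, volume (Metric.closedBall y ε - (Ξ₀ ω : Set (EuclideanSpace ℝ (Fin d)))) ∂P =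
      meanDilatedVolume P Ξ₀ ε :=
  lintegral_congr fun ω => volume_closedBall_sub y ε (Ξ₀ ω).isCompact

theorem ae_isClosed_grainUnion (h : IsPoissonGrainModel P lam Ξ₀ X Ξ) {ε : ℝ} (hε : 0 < ε)
    (hfin : meanDilatedVolume P Ξ₀ ε < ∞) : ∀ᵐ ω ∂P, IsClosed (grainUnion X Ξ ω) := by
  have hy (y : EuclideanSpace ℝ (Fin d)) :
      ∀ᵐ ω ∂P, {i | (X i ω, Ξ i ω) ∈ hittingPairs (Metric.closedBall y ε)}.Finite := by
    refine ae_finite_setOfPred_mem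
      (s := fun i => {ω | (X i ω, Ξ i ω) ∈ hittingPairs (Metric.closedBall y ε)}) ?_
    rw [h.tsum_measure_mem (measurableSet_hittingPairs (isCompact_closedBall y ε)),
      h.prod_hittingPairs (isCompact_closedBall y ε), lintegral_volume_closedBall_sub]
    exact ENNReal.mul_ne_top ENNReal.coe_ne_top hfin.ne
  filter_upwards [ae_all_iff.2 fun n => hy (denseSeq _ n)] with ω hω
  refine LocallyFinite.isClosed_iUnion (fun x => ?_)
    fun i => ((Ξ i ω).isCompact.add isCompact_singleton).isClosed
  obtain ⟨n, hn⟩ := (denseRange_denseSeq (EuclideanSpace ℝ (Fin d))).exists_dist_lt x hε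
  exact ⟨_, Metric.closedBall_mem_nhds_of_mem hn, hω n⟩

theorem ae_dense_grainUnion (h : IsPoissonGrainModel P lam Ξ₀ X Ξ) (hlam : 0 < lam)
    (hinf : ∀ ε : ℝ, 0 < ε → meanDilatedVolume P Ξ₀ ε = ∞) :
    ∀ᵐ ω ∂P, Dense (grainUnion X Ξ ω) := by
  have hy (y : EuclideanSpace ℝ (Fin d)) {ε : ℝ} (hε : 0 < ε) :
      ∀ᵐ ω ∂P, ¬ Disjoint (grainUnion X Ξ ω) (Metric.closedBall y ε) := by
    rw [ae_iff]
    simp only [not_not]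
    rw [h.measure_disjoint_grainUnion (isCompact_closedBall y ε), lintegral_volume_closedBall_sub,
      hinf ε hε, ENNReal.mul_top (by exact_mod_cast hlam.ne'), negExp_top]
  filter_upwards [ae_all_iff.2 fun n => ae_all_iff.2 fun k : ℕ =>
    hy (denseSeq _ n) (Nat.one_div_pos_of_nat (α := ℝ) (n := k))] with ω hω
  refine Metric.dense_iff.2 fun x r hr => ?_
  obtain ⟨k, hk⟩ := exists_nat_one_div_lt (half_pos hr)
  obtain ⟨n, hn⟩ :=
    (denseRange_denseSeq (EuclideanSpace ℝ (Fin d))).exists_dist_lt x (half_pos hr)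
  obtain ⟨z, hz, hzb⟩ := Set.not_disjoint_iff.1 (hω n k)
  refine ⟨z, ?_, hz⟩
  rw [Metric.mem_ball]
  linarith [dist_triangle_right z x (denseSeq _ n), Metric.mem_closedBall.1 hzb]

omit [IsProbabilityMeasure P] in
lemma tendsto_lintegral_volume_pair_sub (h : IsPoissonGrainModel P lam Ξ₀ X Ξ)
    (hvol : meanVolume P Ξ₀ < ∞) :
    Filter.Tendsto (fun z => ∫⁻ ω, volume ({0, z} - (Ξ₀ ω : Set (EuclideanSpace ℝ (Fin d)))) ∂P)
      (Bornology.cobounded _) (nhds (2 * meanVolume P Ξ₀)) := by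
  have hmeas : Measurable fun ω => volume ((Ξ₀ ω : Set (EuclideanSpace ℝ (Fin d)))) := by
    simpa only [volume_singleton_sub _ (Ξ₀ _).isCompact] using
      h.measurable_volume_sub (isCompact_singleton (x := (0 : EuclideanSpace ℝ (Fin d))))
  have h2 : 2 * meanVolume P Ξ₀ =
      ∫⁻ ω, 2 * volume ((Ξ₀ ω : Set (EuclideanSpace ℝ (Fin d)))) ∂P :=
    (lintegral_const_mul _ hmeas).symm
  rw [h2]
  have : (Bornology.cobounded (EuclideanSpace ℝ (Fin d))).IsCountablyGenerated := by
    rw [← comap_norm_atTop]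
    infer_instance
  refine tendsto_lintegral_filter_of_dominated_convergence
    (fun ω => 2 * volume ((Ξ₀ ω : Set (EuclideanSpace ℝ (Fin d)))))
    (.of_forall fun z => ?_) (.of_forall fun z => .of_forall fun ω => ?_) ?_
    (.of_forall fun ω => ?_)
  · exact h.measurable_volume_sub (isCompact_singleton.insert _)
  · exact volume_pair_sub_le z (Ξ₀ ω).isCompact
  · rw [← h2]
    exact ENNReal.mul_ne_top ENNReal.ofNat_ne_top hvol.ne
  · exact tendsto_const_nhds.congr'
      ((eventually_volume_pair_sub_eq (Ξ₀ ω).isCompact).mono fun z hz => hz.symm)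

/-- A Poisson grain model whose typical grain has finite mean volume almost surely does not cover
the whole space. -/
theorem ae_grainUnion_ne_univ (h : IsPoissonGrainModel P lam Ξ₀ X Ξ) (hd : 1 ≤ d)
    (hvol : meanVolume P Ξ₀ < ∞) : ∀ᵐ ω ∂P, grainUnion X Ξ ω ≠ Set.univ := by
  have hfin : (lam : ℝ≥0∞) * meanVolume P Ξ₀ ≠ ∞ := ENNReal.mul_ne_top ENNReal.coe_ne_top hvol.ne
  let a : ℝ := (lam * meanVolume P Ξ₀).toReal
  let q : ℝ := Real.exp (-a)
  have hqE : negExp (lam * meanVolume P Ξ₀) = ENNReal.ofReal q := by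
    rw [← negExp_ofReal ENNReal.toReal_nonneg, ENNReal.ofReal_toReal hfin]
  have hq0 : 0 < q := Real.exp_pos _
  have hlim : Filter.Tendsto (fun z => (negExp (lam * ∫⁻ ω, volume ({0, z} -
      (Ξ₀ ω : Set (EuclideanSpace ℝ (Fin d)))) ∂P)).toReal) (Bornology.cobounded _)
      (nhds (q ^ 2)) := by
    have hval : negExp (lam * (2 * meanVolume P Ξ₀)) = ENNReal.ofReal (q ^ 2) := by
      rw [mul_left_comm, two_mul, negExp_add, hqE, ← ENNReal.ofReal_mul hq0.le, sq]
    have h1 := (continuous_negExp.tendsto _).comp (ENNReal.Tendsto.const_mul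
      (a := (lam : ℝ≥0∞)) (h.tendsto_lintegral_volume_pair_sub hvol) (.inr ENNReal.coe_ne_top))
    rw [hval] at h1
    have h2 := (ENNReal.tendsto_toReal ENNReal.ofReal_ne_top).comp h1
    rwa [ENNReal.toReal_ofReal (sq_nonneg q)] at h2
  have hmain {δ : ℝ} (hδ : 0 < δ) :
      q ^ 2 * P.real {ω | grainUnion X Ξ ω = Set.univ} ≤ 2 * δ := by
    obtain ⟨R, -, hR⟩ := (Filter.hasBasis_cobounded_norm
      (E := EuclideanSpace ℝ (Fin d))).eventually_iff.1
      (hlim.eventually (ge_mem_nhds (lt_add_of_pos_right (q ^ 2) hδ)))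
    let e : EuclideanSpace ℝ (Fin d) := EuclideanSpace.single ⟨0, hd⟩ 1
    let y : ℕ → EuclideanSpace ℝ (Fin d) := fun j => ((j : ℝ) * |R|) • e
    have hy j k (hjk : j ≠ k) : R ≤ ‖y k - y j‖ := by
      have h1 : (1 : ℝ) ≤ |(k : ℝ) - j| := by
        have : (1 : ℤ) ≤ |(k : ℤ) - j| := Int.one_le_abs (by omega)
        exact_mod_cast this
      have h2 : ‖y k - y j‖ = |(k : ℝ) - j| * |R| := by
        rw [← sub_smul, norm_smul, ← sub_mul, Real.norm_eq_abs, abs_mul, abs_abs]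
        simp [e]
      rw [h2]
      nlinarith [abs_nonneg R, le_abs_self R]
    let V : ℕ → Set Ω := fun j => {ω | Disjoint (grainUnion X Ξ ω) {y j}}
    have hV j : MeasurableSet (V j) := h.measurableSet_disjoint_grainUnion isCompact_singleton
    have hVq j : P.real (V j) = q := by
      rw [measureReal_def, h.measure_disjoint_grainUnion isCompact_singleton]
      simp_rw [fun ω => volume_singleton_sub (y j) (Ξ₀ ω).isCompact]
      change (negExp (lam * meanVolume P Ξ₀)).toReal = q
      rw [hqE, ENNReal.toReal_ofReal hq0.le]
    have hVV j k (hjk : j ≠ k) : P.real (V j ∩ V k) ≤ q ^ 2 + δ := by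
      have hset : V j ∩ V k = {ω | Disjoint (grainUnion X Ξ ω) {y j, y k}} := by
        ext ω
        rw [Set.mem_ofPred_eq, Set.insert_eq, Set.disjoint_union_right]
        rfl
      rw [hset, measureReal_def,
        h.measure_disjoint_grainUnion (isCompact_singleton.insert _)]
      simp_rw [volume_pair_sub (y j) (y k)]
      exact hR (hy j k hjk)
    obtain ⟨n, hn⟩ := exists_nat_one_div_lt hδ
    have h1 := measureReal_forall_notMem_mul_le hV hδ.le hVq hVV (n + 1)
    have h2 : P.real {ω | grainUnion X Ξ ω = Set.univ} ≤ P.real {ω | ∀ j, ω ∉ V j} := by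
      refine measureReal_mono fun ω hω j hj => ?_
      have hω' : grainUnion X Ξ ω = Set.univ := hω
      have hj' : Disjoint (grainUnion X Ξ ω) {y j} := hj
      simp [hω'] at hj'
    refine (mul_le_mul_of_nonneg_left h2 (sq_nonneg q)).trans ?_
    have hn1 : (0 : ℝ) < n + 1 := by positivity
    have hn2 : 1 ≤ δ * (n + 1) := by
      rw [div_lt_iff₀ hn1] at hn
      exact hn.le
    push_cast at h1
    refine le_of_mul_le_mul_left ?_ (pow_pos hn1 2)
    nlinarith
  rw [ae_iff]
  simp only [ne_eq, not_not]
  rw [← measureReal_eq_zero_iff]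
  by_contra hne
  have hpos : 0 < q ^ 2 * P.real {ω | grainUnion X Ξ ω = Set.univ} :=
    mul_pos (pow_pos hq0 2) (measureReal_nonneg.lt_of_ne' hne)
  have := hmain (δ := q ^ 2 * P.real {ω | grainUnion X Ξ ω = Set.univ} / 4) (by positivity)
  linarith

theorem ae_not_isClosed_grainUnion (h : IsPoissonGrainModel P lam Ξ₀ X Ξ) (hd : 1 ≤ d)
    (hlam : 0 < lam) (hvol : meanVolume P Ξ₀ < ∞)
    (hinf : ∀ ε : ℝ, 0 < ε → meanDilatedVolume P Ξ₀ ε = ∞) :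
    ∀ᵐ ω ∂P, ¬ IsClosed (grainUnion X Ξ ω) := by
  filter_upwards [h.ae_dense_grainUnion hlam hinf, h.ae_grainUnion_ne_univ hd hvol] with ω h1 h2 h3
  exact h2 (h3.closure_eq.symm.trans h1.closure_eq)

end IsPoissonGrainModel

theorem proposition2 {d : ℕ} (hd : 1 ≤ d) {Ω : Type*} [MeasurableSpace Ω] (P : Measure Ω)
    [IsProbabilityMeasure P] (lam : ℝ≥0) (hlam : 0 < lam)
    (Ξ₀ : Ω → NonemptyCompacts (EuclideanSpace ℝ (Fin d)))
    (X : ℕ → Ω → EuclideanSpace ℝ (Fin d))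
    (Ξ : ℕ → Ω → NonemptyCompacts (EuclideanSpace ℝ (Fin d)))
    (hΞ : IsPoissonGrainModel P lam Ξ₀ X Ξ)
    (hvol : meanVolume P Ξ₀ < ∞) :
    ((∀ ε : ℝ, 0 < ε → meanDilatedVolume P Ξ₀ ε = ∞) →
      ∀ᵐ ω ∂P, ¬ IsClosed (grainUnion X Ξ ω)) ∧
    ((∀ᵐ ω ∂P, IsClosed (grainUnion X Ξ ω)) ↔
      ∃ ε : ℝ, 0 < ε ∧ meanDilatedVolume P Ξ₀ ε < ∞) := by
  refine ⟨hΞ.ae_not_isClosed_grainUnion hd hlam hvol, fun hcl => ?_,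
    fun ⟨ε, hε, hfin⟩ => hΞ.ae_isClosed_grainUnion hε hfin⟩
  by_contra! hinf
  obtain ⟨ω, h1, h2⟩ := (hcl.and (hΞ.ae_not_isClosed_grainUnion hd hlam hvol
    fun ε hε => top_le_iff.1 (hinf ε hε))).exists
  exact h2 h1
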